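/- Let $\mathbb K=\mathbb R$ or $\mathbb C$, let $\Omega$ be a non-empty set, and let $\mathcal F(\Omega)$ be a linear space of $\mathbb K$-valued functions on $\Omega$, equipped with a locally convex Hausdorff topology $\tau$. For a locally convex Hausdorff space $Z$ let $Z_b'$ be its topological dual with the topology of uniform convergence on bounded subsets of $Z$. A predual of $(\mathcal F(\Omega),\tau)$ is a pair $(Z,\varphi)$ of a locally convex Hausdorff space $Z$ over $\mathbb K$ and a topological isomorphism $\varphi\colon(\mathcal F(\Omega),\tau)\to Z_b'$. For a class $\mathcal C$ of locally convex Hausdorff spaces over $\mathbb K$, $(\mathcal F(\Omega),\tau)$ has a unique $\mathcal C$ predual if for all preduals $(Y,\varphi)$ and $(Z,\psi)$ of it with $Y,Z\in\mathcal C$ there is a topological isomorphism $Y\to Z$. Suppose that $(\mathcal F(\Omega),\tau)$ is bornological and a BC-space, i.e. every linear map with closed graph from a Banach space to $(\mathcal F(\Omega),\tau)$ is continuous. Suppose that there is a locally convex Hausdorff topology $\widetilde\tau$ on $\mathcal F(\Omega)$, finer than or equal to the topology of pointwise convergence on $\Omega$, such that - (BBC) every $\tau$-bounded set is contained in an absolutely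 convex $\tau$-bounded $\widetilde\tau$-compact set, and - (CNC) $\tau$ has a $0$-neighbourhood basis of absolutely convex $\widetilde\tau$-closed sets. Let $\mathcal B$ be the family of $\tau$-bounded sets, and let $\mathcal F(\Omega)_{\mathcal B,\widetilde\tau}'$ be the space of all linear functionals on $\mathcal F(\Omega)$ whose restriction to each $B\in\mathcal B$ is $\widetilde\tau$-continuous, equipped with the topology of uniform convergence on the sets $B\in\mathcal B$. Let $\mathcal C$ be a subclass of the class of complete barrelled locally convex Hausdorff spaces over $\mathbb K$ such that $\mathcal C$ is closed under topological isomorphisms and $\mathcal F(\Omega)_{\mathcal B,\widetilde\tau}'\in\mathcal C$. Then the following assertions are equivalent. (a) $(\mathcal F(\Omega),\tau)$ has a unique $\mathcal C$ predual. (b) For every predual $(Z,\varphi)$ of $(\mathcal F(\Omega),\tau)$ with $Z\in\mathcal C$ there is a topological isomorphism $\psi\colon(\mathcal F(\Omega),\tau)\to Z_b'$ such that for every $x\in\Omega$ there is a (unique) $z_x\in Z$ with $f(x)=\psi(f)(z_x)$ for all $f\in\mathcal F(\Omega)$. -/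

import Mathlib

open Topology
open scoped ComplexOrder

universe u v

namespace Predual

/-- A Hausdorff locally convex topological vector space over `𝕜 = ℝ` or `ℂ`. -/
class LCHSpace (𝕜 : Type v) (X : Type u) [RCLike 𝕜] [AddCommGroup X] [Module 𝕜 X]
    [TopologicalSpace X] : Prop extends
    IsTopologicalAddGroup X, ContinuousSMul 𝕜 X, LocallyConvexSpace 𝕜 X, T2Space X

section Topologies

variable (𝕜 : Type v) {X : Type u} [RCLike 𝕜] [AddCommGroup X] [Module 𝕜 X]

/-- `τ` is a locally convex Hausdorff (vector space) topology on `X`. -/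
def IsLCHTopology (τ : TopologicalSpace X) : Prop :=
  @LCHSpace 𝕜 X _ _ _ τ

/-- The family of `τ`-bounded subsets of `X`. -/
def boundedSets (τ : TopologicalSpace X) : Set (Set X) :=
  {B | @Bornology.IsVonNBounded 𝕜 X _ _ _ τ B}

/-- `(X, τ)` is bornological: every absolutely convex set that absorbs all `τ`-bounded sets is a
`0`-neighbourhood. -/
def IsBornologicalTopology (τ : TopologicalSpace X) : Prop :=
  ∀ U : Set X, AbsConvex 𝕜 U → (∀ B ∈ boundedSets 𝕜 τ, Absorbs 𝕜 U B) → U ∈ @nhds X τ 0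

/-- `(X, τ)` is a BC-space: every linear map from a Banach space to `X` whose graph is closed is
continuous. (Banach spaces in the universe of `X` suffice: passing to the quotient by the kernel,
which is closed, one may assume that the map is injective.) -/
def IsBCTopology (τ : TopologicalSpace X) : Prop :=
  ∀ (E : Type u) [NormedAddCommGroup E] [NormedSpace 𝕜 E] [CompleteSpace E] (f : E →ₗ[𝕜] X),
    IsClosed {p : E × X | p.2 = f p.1} → Continuous f

/-- Condition (BBC) of `(X, τ)` for `τt`: every `τ`-bounded set is contained in an absolutely convex
`τ`-bounded `τt`-compact set. -/
def SatisfiesBBC (τ τt : TopologicalSpace X) : Prop :=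
  ∀ B ∈ boundedSets 𝕜 τ, ∃ K ∈ boundedSets 𝕜 τ, B ⊆ K ∧ AbsConvex 𝕜 K ∧ @IsCompact X τt K

/-- Condition (CNC) of `(X, τ)` for `τt`: `τ` has a `0`-neighbourhood basis of absolutely convex
`τt`-closed sets. -/
def SatisfiesCNC (τ τt : TopologicalSpace X) : Prop :=
  ∀ V ∈ @nhds X τ 0, ∃ U ∈ @nhds X τ 0, U ⊆ V ∧ AbsConvex 𝕜 U ∧ IsClosed[τt] U

/-- The linear functionals on `X` whose restrictions to all `τ`-bounded sets are
`τt`-continuous. -/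
def boundedlyContinuousDual (τ τt : TopologicalSpace X) : Submodule 𝕜 (Module.Dual 𝕜 X) where
  carrier := {u | ∀ B ∈ boundedSets 𝕜 τ, @ContinuousOn X 𝕜 τt _ u B}
  add_mem' hu hw B hB := @ContinuousOn.add 𝕜 _ _ _ X τt _ _ _ (hu B hB) (hw B hB)
  zero_mem' _ _ := @continuousOn_const X 𝕜 τt _ _ _
  smul_mem' c _ hu B hB := @ContinuousOn.const_smul 𝕜 𝕜 X _ _ _ τt _ _ (hu B hB) c

/-- The space `X'_{𝓑,τt}`, where `𝓑` is the family of `τ`-bounded sets. -/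
def BoundedlyContinuousDual (τ τt : TopologicalSpace X) : Type (max u v) :=
  boundedlyContinuousDual 𝕜 τ τt

namespace BoundedlyContinuousDual

variable (τ τt : TopologicalSpace X)

instance : AddCommGroup (BoundedlyContinuousDual 𝕜 τ τt) :=
  inferInstanceAs (AddCommGroup (boundedlyContinuousDual 𝕜 τ τt))

instance : Module 𝕜 (BoundedlyContinuousDual 𝕜 τ τt) :=
  inferInstanceAs (Module 𝕜 (boundedlyContinuousDual 𝕜 τ τt))

variable {𝕜 τ τt} in
/-- The underlying linear functional. -/
def toDual (u : BoundedlyContinuousDual 𝕜 τ τt) : Module.Dual 𝕜 X :=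
  u.1

/-- The topology `β` of uniform convergence on the `τ`-bounded sets. -/
instance : TopologicalSpace (BoundedlyContinuousDual 𝕜 τ τt) :=
  TopologicalSpace.induced
    (fun u => UniformOnFun.ofFun (boundedSets 𝕜 τ) (fun x => u.toDual x)) inferInstance

end BoundedlyContinuousDual

/-- Topological isomorphisms `φ : (X, τ) → Z_b'` onto the strong dual of `Z`; for a locally convex
Hausdorff space `Z`, these are the maps `φ` such that `(Z, φ)` is a predual of `(X, τ)`.
(Mathlib's `StrongDual 𝕜 Z` carries the topology of uniform convergence on bounded sets.) -/
abbrev PredualIso (τ : TopologicalSpace X) (Z : Type*) [AddCommGroup Z] [Module 𝕜 Z]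
    [TopologicalSpace Z] :=
  @ContinuousLinearEquiv 𝕜 𝕜 _ _ (RingHom.id 𝕜) (RingHom.id 𝕜) _ _ X τ _
    (StrongDual 𝕜 Z) _ _ _ _

end Topologies

section Classes

/-- A property of topological vector spaces over `𝕜`, viewed as the class of the spaces having
it. -/
abbrev SpaceClass (𝕜 : Type v) [RCLike 𝕜] :=
  ∀ (Z : Type u) [AddCommGroup Z] [Module 𝕜 Z] [TopologicalSpace Z], Prop

/-- Completeness of `Z` with respect to its canonical (translation invariant) uniformity. -/
def IsCompleteTVS (Z : Type u) [AddCommGroup Z] [TopologicalSpace Z] [IsTopologicalAddGroup Z] :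
    Prop :=
  @CompleteSpace Z (IsTopologicalAddGroup.rightUniformSpace Z)

variable {𝕜 : Type v} [RCLike 𝕜]

/-- `C` is a subclass of the class of complete barrelled locally convex Hausdorff spaces. -/
def SpaceClass.SubCompleteBarrelled (C : SpaceClass.{u} 𝕜) : Prop :=
  ∀ (Z : Type u) [AddCommGroup Z] [Module 𝕜 Z] [TopologicalSpace Z], C Z →
    ∃ _ : LCHSpace 𝕜 Z, IsCompleteTVS Z ∧ BarrelledSpace 𝕜 Z

/-- `C` is closed under topological isomorphisms. -/
def SpaceClass.ClosedUnderIso (C : SpaceClass.{u} 𝕜) : Prop :=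
  ∀ (Y Z : Type u) [AddCommGroup Y] [Module 𝕜 Y] [TopologicalSpace Y]
    [AddCommGroup Z] [Module 𝕜 Z] [TopologicalSpace Z] [LCHSpace 𝕜 Z],
    C Y → Nonempty (Y ≃L[𝕜] Z) → C Z

/-- `(X, τ)` has a unique `C` predual: for all preduals `(Y, φ)` and `(Z, ψ)` with `Y, Z ∈ C` the
spaces `Y` and `Z` are topologically isomorphic. -/
def HasUniquePredual {X : Type*} [AddCommGroup X] [Module 𝕜 X] (τ : TopologicalSpace X)
    (C : SpaceClass.{u} 𝕜) : Prop :=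
  ∀ (Y Z : Type u) [AddCommGroup Y] [Module 𝕜 Y] [TopologicalSpace Y] [LCHSpace 𝕜 Y]
    [AddCommGroup Z] [Module 𝕜 Z] [TopologicalSpace Z] [LCHSpace 𝕜 Z]
    (_φ : PredualIso 𝕜 τ Y) (_ψ : PredualIso 𝕜 τ Z), C Y → C Z → Nonempty (Y ≃L[𝕜] Z)

end Classes

/-- The topology of pointwise convergence on a linear space `F` of functions `Ω → 𝕜`. -/
@[reducible] def pointwiseTopology {𝕜 : Type v} [RCLike 𝕜] {Ω : Type u} (F : Submodule 𝕜 (Ω → 𝕜)) :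
    TopologicalSpace F :=
  TopologicalSpace.induced (fun f => (f : Ω → 𝕜)) Pi.topologicalSpace

end Predual

/-! Write `X` for the function space and `W` for `BoundedlyContinuousDual`. Evaluation maps `X`
isomorphically onto the strong dual of `W` (`evalIso`): onto by (BBC) and a Mackey–Arens argument,
continuous because `X` is bornological, open by (CNC) and the bipolar theorem. So `W` is a predual
in `C`, and it contains all point evaluations since these are `τt`-continuous. Under (a) every
predual `Z` in `C` is isomorphic to `W`, and transporting `evalIso` gives (b).

Conversely, (b) forces `Z ≃ W` (`PredualIso.nonempty_equiv_of_points`). The `z_x` span a dense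
subspace of `Z`, as only `f = 0` vanishes at every point. By barrelledness, `Z` carries the topology
of uniform convergence on `τ`-bounded sets, so uniform limits place `Z` inside `W` with the induced
topology. The image is closed by completeness and dense by Hahn–Banach, because the dual of `W` is
`X`. -/

namespace Predual

/-! ### Polars in a dual pairing -/

section Polars

variable {𝕜 : Type*} [RCLike 𝕜] {E F : Type*} [AddCommGroup E] [Module 𝕜 E]
  [AddCommGroup F] [Module 𝕜 F]

theorem absConvex_polar (b : E →ₗ[𝕜] F →ₗ[𝕜] 𝕜) (s : Set E) : AbsConvex 𝕜 (b.polar s) := by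
  constructor
  · rintro c hc _ ⟨y, hy, rfl⟩ x hx
    simpa using mul_le_one₀ hc (norm_nonneg _) (hy x hx)
  · intro y hy z hz p q hp hq hpq x hx
    obtain ⟨p, hp0, rfl⟩ := RCLike.nonneg_iff_exists_ofReal.mp hp
    obtain ⟨q, hq0, rfl⟩ := RCLike.nonneg_iff_exists_ofReal.mp hq
    have hpq : p + q = 1 := by exact_mod_cast hpq
    calc ‖b x ((p : 𝕜) • y + (q : 𝕜) • z)‖ ≤ p * ‖b x y‖ + q * ‖b x z‖ := by
          simpa [abs_of_nonneg (show 0 ≤ p from hp0), abs_of_nonneg (show 0 ≤ q from hq0)]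
            using norm_add_le (p * b x y) (q * b x z)
      _ ≤ p * 1 + q * 1 := by gcongr; exacts [hy x hx, hz x hx]
      _ = 1 := by simpa using hpq

/-- The bound on the right is symmetric in `s` and `t`, so the two sets can exchange roles. -/
theorem absorbs_polar_iff (b : E →ₗ[𝕜] F →ₗ[𝕜] 𝕜) (s : Set E) (t : Set F) :
    Absorbs 𝕜 (b.polar s) t ↔ ∃ M : ℝ, ∀ x ∈ s, ∀ y ∈ t, ‖b x y‖ ≤ M := by
  rw [absorbs_iff_norm]
  constructor
  · rintro ⟨r, hr⟩
    obtain ⟨c, hc⟩ := NormedField.exists_lt_norm 𝕜 r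
    refine ⟨‖c‖, fun x hx y hy => ?_⟩
    obtain ⟨z, hz, rfl⟩ := hr c hc.le hy
    simpa using mul_le_of_le_one_right (norm_nonneg c) (hz x hx)
  · rintro ⟨M, hM⟩
    refine ⟨max M 1, fun c hc y hy => ?_⟩
    have hc0 : 0 < ‖c‖ := lt_of_lt_of_le one_pos ((le_max_right _ _).trans hc)
    rw [Set.mem_smul_set_iff_inv_smul_mem₀ (norm_pos_iff.mp hc0)]
    intro x hx
    simpa [inv_mul_le_iff₀ hc0] using (hM x hx y hy).trans ((le_max_left _ _).trans hc)

end Polars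

/-! ### Separation from absolutely convex closed sets -/

section HahnBanach

variable {𝕜 : Type*} [RCLike 𝕜] {E : Type*} [AddCommGroup E] [Module 𝕜 E] [TopologicalSpace E]
  [IsTopologicalAddGroup E] [ContinuousSMul 𝕜 E]

theorem exists_strongDual_lt_norm_of_real [Module ℝ E] [IsScalarTower ℝ 𝕜 E]
    [LocallyConvexSpace ℝ E] {s : Set E} (hs : AbsConvex 𝕜 s) (hne : s.Nonempty)
    (hc : IsClosed s) {x : E} (hx : x ∉ s) :
    ∃ f : StrongDual 𝕜 E, (∀ y ∈ s, ‖f y‖ ≤ 1) ∧ 1 < ‖f x‖ := by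
  obtain ⟨f, r, hf, hr⟩ := RCLike.geometric_hahn_banach_closed_point (𝕜 := 𝕜)
    (convex_RCLike_iff_convex_real.mp hs.2) hc hx
  have hr0 : 0 < r := by simpa using hf 0 (hs.1.zero_mem hne)
  refine ⟨((r : 𝕜)⁻¹) • f, fun y hy => ?_, ?_⟩
  · obtain ⟨c, hc1, hcy⟩ := RCLike.exists_norm_eq_mul_self (f y)
    have h := hf (c • y) (hs.1.smul_mem hc1.le hy)
    rw [map_smul, smul_eq_mul, ← hcy, RCLike.ofReal_re] at h
    simpa [abs_of_pos hr0, inv_mul_le_iff₀ hr0] using h.le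
  · have h := hr.trans_le (RCLike.re_le_norm (f x))
    simpa [abs_of_pos hr0, lt_inv_mul_iff₀ hr0] using h

theorem exists_strongDual_lt_norm [LocallyConvexSpace 𝕜 E] {s : Set E} (hs : AbsConvex 𝕜 s)
    (hne : s.Nonempty) (hc : IsClosed s) {x : E} (hx : x ∉ s) :
    ∃ f : StrongDual 𝕜 E, (∀ y ∈ s, ‖f y‖ ≤ 1) ∧ 1 < ‖f x‖ := by
  let : Module ℝ E := Module.compHom E (algebraMap ℝ 𝕜)
  have : IsScalarTower ℝ 𝕜 E := ⟨fun a b z => by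
    rw [Algebra.smul_def, mul_smul]; rfl⟩
  have : LocallyConvexSpace ℝ E := ⟨fun y =>
    (LocallyConvexSpace.convex_basis (𝕜 := 𝕜) y).congr
      (fun _ => by rw [convex_RCLike_iff_convex_real]) fun _ _ => rfl⟩
  exact exists_strongDual_lt_norm_of_real hs hne hc hx

/-- A subspace is dense if no nonzero continuous functional vanishes on it. -/
theorem mem_closure_submodule_of_forall_strongDual [LocallyConvexSpace 𝕜 E] (S : Submodule 𝕜 E)
    (h : ∀ f : StrongDual 𝕜 E, (∀ y ∈ S, f y = 0) → f = 0) (x : E) : x ∈ closure (S : Set E) := by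
  by_contra hx
  have hS : AbsConvex 𝕜 (S : Set E) :=
    ⟨fun c _ => by rintro _ ⟨y, hy, rfl⟩; exact S.smul_mem c hy,
      fun y hy z hz p q _ _ _ => S.add_mem (S.smul_mem p hy) (S.smul_mem q hz)⟩
  obtain ⟨f, hf, hfx⟩ := exists_strongDual_lt_norm hS.closure ⟨0, subset_closure S.zero_mem⟩
    isClosed_closure hx
  have hf0 : f = 0 := h f fun y hy => by
    by_contra hy0
    obtain ⟨c, hc⟩ := NormedField.exists_lt_norm 𝕜 (‖f y‖⁻¹)
    have := hf (c • y) (subset_closure (S.smul_mem c hy))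
    rw [map_smul, smul_eq_mul, norm_mul] at this
    rw [inv_lt_iff_one_lt_mul₀ (norm_pos_iff.mpr hy0)] at hc
    linarith
  simp [hf0] at hfx
  linarith

theorem eq_zero_of_forall_strongDual_eq_zero [LocallyConvexSpace 𝕜 E] [T2Space E] {x : E}
    (h : ∀ f : StrongDual 𝕜 E, f x = 0) : x = 0 := by
  by_contra hx
  have h0 : AbsConvex 𝕜 ({0} : Set E) :=
    ⟨fun c _ => by simp, convex_singleton 0⟩
  obtain ⟨f, -, hf⟩ := exists_strongDual_lt_norm h0 ⟨0, rfl⟩ isClosed_singleton hx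
  simp [h f] at hf
  linarith

end HahnBanach

/-! ### Representing functionals by points of a compact set -/

section MackeyArens

variable {𝕜 : Type*} [RCLike 𝕜] {X W : Type*} [AddCommGroup X] [Module 𝕜 X]
  [AddCommGroup W] [Module 𝕜 W]

theorem exists_lt_norm_of_isClosed_weakBilin (b : X →ₗ[𝕜] W →ₗ[𝕜] 𝕜) {s : Set (WeakBilin b)}
    (hs : AbsConvex 𝕜 s) (hne : s.Nonempty) (hc : IsClosed s) {x : WeakBilin b} (hx : x ∉ s) :
    ∃ w : W, (∀ y ∈ s, ‖b y w‖ ≤ 1) ∧ 1 < ‖b x w‖ := by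
  let : Module ℝ X := Module.compHom X (algebraMap ℝ 𝕜)
  have : IsScalarTower ℝ 𝕜 X := ⟨fun a b z => by
    rw [Algebra.smul_def, mul_smul]; rfl⟩
  obtain ⟨g, hg, hgx⟩ := exists_strongDual_lt_norm_of_real hs hne hc hx
  obtain ⟨w, rfl⟩ := LinearMap.dualEmbedding_surjective b g
  exact ⟨w, hg, hgx⟩

/-- A linear functional on `W` which is bounded on the polar of an absolutely convex set `K` is the
evaluation at a point of `K` if `K` is compact for a topology for which the elements of `W` are
continuous on `K`. -/
theorem exists_mem_forall_eq_of_isCompact [TopologicalSpace X] (b : W →ₗ[𝕜] X →ₗ[𝕜] 𝕜) {K : Set X}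
    (hK : AbsConvex 𝕜 K) (hne : K.Nonempty) (hc : IsCompact K)
    (hb : ∀ w, ContinuousOn (b w) K) (T : W →ₗ[𝕜] 𝕜)
    (hT : ∀ w, (∀ f ∈ K, ‖b w f‖ ≤ 1) → ‖T w‖ ≤ 1) : ∃ f ∈ K, ∀ w, T w = b w f := by
  -- In the algebraic dual of `W` with its weak topology, the image of `K` is compact, hence closed;
  -- were `T` outside it, a separating `w : W` would contradict `hT`.
  let B : Module.Dual 𝕜 W →ₗ[𝕜] W →ₗ[𝕜] 𝕜 := LinearMap.id
  have hinj : Function.Injective B := fun _ _ h => h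
  have : T2Space (WeakBilin B) := (WeakBilin.isEmbedding hinj).t2Space
  let e : X →ₗ[𝕜] WeakBilin B := b.flip
  have he : ContinuousOn e K := by
    rw [(WeakBilin.isEmbedding hinj).continuousOn_iff]
    exact continuousOn_pi.mpr hb
  have hcl : IsClosed (e '' K) := (hc.image_of_continuousOn he).isClosed
  have habs : AbsConvex 𝕜 (e '' K) := by
    refine ⟨fun c hc' => ?_, hK.2.linear_image e⟩
    rintro _ ⟨_, ⟨f, hf, rfl⟩, rfl⟩
    exact ⟨c • f, hK.1.smul_mem hc' hf, map_smul e c f⟩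
  by_contra hcon
  let T' : WeakBilin B := T
  have hTm : T' ∉ e '' K := by
    rintro ⟨f, hf, hfT⟩
    exact hcon ⟨f, hf, fun w => (DFunLike.congr_fun (show b.flip f = T from hfT) w).symm⟩
  obtain ⟨w, hw, hwT⟩ := exists_lt_norm_of_isClosed_weakBilin B habs (hne.image e) hcl hTm
  exact absurd (hT w fun f hf => hw (e f) ⟨f, hf, rfl⟩) (not_le.mpr hwT)

end MackeyArens

open scoped Pointwise

/-! ### Neighbourhoods and bounded sets in strong duals -/

section StrongDual

variable {𝕜 : Type*} [RCLike 𝕜] {E F : Type*} [AddCommGroup E] [Module 𝕜 E]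
  [AddCommGroup F] [Module 𝕜 F]

theorem polar_smul_set (b : E →ₗ[𝕜] F →ₗ[𝕜] 𝕜) {r : ℝ} (hr : 0 < r) (s : Set E) :
    b.polar (((r : 𝕜)⁻¹) • s) = {y | ∀ x ∈ s, ‖b x y‖ ≤ r} := by
  ext y
  simp [LinearMap.polar, Set.mem_smul_set, abs_of_pos hr, inv_mul_le_iff₀ hr]

variable [TopologicalSpace E]

theorem mem_nhds_zero_strongDual_iff [ContinuousSMul 𝕜 E] {V : Set (StrongDual 𝕜 E)} :
    V ∈ 𝓝 (0 : StrongDual 𝕜 E) ↔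
      ∃ B, Bornology.IsVonNBounded 𝕜 B ∧ (topDualPairing 𝕜 E).flip.polar B ⊆ V := by
  rw [(ContinuousLinearMap.hasBasis_nhds_zero_of_basis (E := E) (F := 𝕜) (σ := RingHom.id 𝕜)
    Metric.nhds_basis_closedBall).mem_iff]
  constructor
  · rintro ⟨⟨B, r⟩, ⟨hB, hr⟩, hV⟩
    refine ⟨((r : 𝕜)⁻¹) • B, hB.image (((r : 𝕜)⁻¹) • ContinuousLinearMap.id 𝕜 E), ?_⟩
    rw [polar_smul_set _ hr]
    exact fun f hf => hV fun x hx => by simpa using hf x hx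
  · rintro ⟨B, hB, hV⟩
    exact ⟨(B, 1), ⟨hB, one_pos⟩, fun f hf => hV fun x hx => by simpa using hf x hx⟩

theorem isVonNBounded_strongDual_polar {U : Set E} (hU : U ∈ 𝓝 (0 : E)) :
    Bornology.IsVonNBounded 𝕜 ((topDualPairing 𝕜 E).flip.polar U) := by
  rw [ContinuousLinearMap.isVonNBounded_iff]
  intro s hs
  obtain ⟨r, hr⟩ := (absorbs_iff_norm.mp (hs hU))
  obtain ⟨c, hc⟩ := NormedField.exists_lt_norm 𝕜 r
  rw [NormedSpace.isVonNBounded_iff, isBounded_iff_forall_norm_le]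
  refine ⟨‖c‖, ?_⟩
  rintro _ ⟨f, hf, x, hx, rfl⟩
  obtain ⟨z, hz, rfl⟩ := hr c hc.le hx
  simpa using mul_le_of_le_one_right (norm_nonneg c) (hf z hz)

/-- Banach–Steinhaus: in a barrelled space the supremum of a pointwise bounded family of continuous
seminorms is continuous. -/
theorem polar_mem_nhds_zero_of_isVonNBounded [IsTopologicalAddGroup E] [ContinuousSMul 𝕜 E]
    [BarrelledSpace 𝕜 E] {S : Set (StrongDual 𝕜 E)} (hS : Bornology.IsVonNBounded 𝕜 S) :
    (topDualPairing 𝕜 E).polar S ∈ 𝓝 (0 : E) := by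
  let p : S → Seminorm 𝕜 E := fun f => (f.1 : E →ₗ[𝕜] 𝕜).toSeminorm
  have hp : ∀ f, Continuous (p f) := fun f => f.1.continuous.norm
  have bdd : BddAbove (Set.range p) := by
    rw [Seminorm.bddAbove_range_iff]
    intro x
    have h := ContinuousLinearMap.isVonNBounded_image2_apply hS
      (Bornology.isVonNBounded_singleton (𝕜 := 𝕜) x)
    rw [NormedSpace.isVonNBounded_iff, isBounded_iff_forall_norm_le] at h
    obtain ⟨C, hC⟩ := h
    exact ⟨C, by rintro _ ⟨f, rfl⟩; exact hC _ ⟨f.1, f.2, x, rfl, rfl⟩⟩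
  have hc : Continuous (⨆ i, p i : Seminorm 𝕜 E) := by
    rw [Seminorm.coe_iSup_eq bdd]
    exact Seminorm.continuous_iSup p hp bdd
  have h0 : ∀ᶠ x in 𝓝 (0 : E), (⨆ i, p i) x < 1 :=
    (isOpen_lt hc continuous_const).mem_nhds (by simp)
  filter_upwards [h0] with x hx f hf
  exact (Seminorm.le_def.mp (le_ciSup bdd ⟨f, hf⟩) x).trans hx.le

end StrongDual

/-! ### The canonical predual -/

section BoundedlyContinuousDual

variable {𝕜 : Type v} {X : Type u} [RCLike 𝕜] [AddCommGroup X] [Module 𝕜 X]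
  {τ τt : TopologicalSpace X}

namespace BoundedlyContinuousDual

variable (𝕜 τ τt) in
/-- The duality between `X'_{𝓑,τt}` and `X`. -/
def pairing : BoundedlyContinuousDual 𝕜 τ τt →ₗ[𝕜] X →ₗ[𝕜] 𝕜 where
  toFun u := u.toDual
  map_add' _ _ := rfl
  map_smul' _ _ := rfl

theorem continuousOn_pairing (u : BoundedlyContinuousDual 𝕜 τ τt) {B : Set X}
    (hB : B ∈ boundedSets 𝕜 τ) : @ContinuousOn X 𝕜 τt _ (pairing 𝕜 τ τt u) B :=
  u.2 B hB

/-- A `τt`-continuous functional as an element of `X'_{𝓑,τt}`. -/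
def ofContinuous (f : X →ₗ[𝕜] 𝕜) (hf : @Continuous X 𝕜 τt _ f) : BoundedlyContinuousDual 𝕜 τ τt :=
  ⟨f, fun _ _ => @Continuous.continuousOn X 𝕜 τt _ _ _ hf⟩

theorem mem_nhds_zero_iff (hτ : IsLCHTopology 𝕜 τ) {V : Set (BoundedlyContinuousDual 𝕜 τ τt)} :
    V ∈ 𝓝 (0 : BoundedlyContinuousDual 𝕜 τ τt) ↔
      ∃ B ∈ boundedSets 𝕜 τ, (pairing 𝕜 τ τt).flip.polar B ⊆ V := by
  let := τ
  have : LCHSpace 𝕜 X := hτ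
  rw [nhds_induced]
  have h := (UniformOnFun.hasBasis_nhds_zero_of_basis (boundedSets 𝕜 τ)
    ⟨∅, Bornology.isVonNBounded_empty 𝕜 X⟩
    (directedOn_of_sup_mem fun _ _ => Bornology.IsVonNBounded.union)
    (Metric.nhds_basis_closedBall (x := (0 : 𝕜)))).comap
      (fun u : BoundedlyContinuousDual 𝕜 τ τt =>
        UniformOnFun.ofFun (boundedSets 𝕜 τ) (fun x => u.toDual x))
  refine h.mem_iff.trans ?_
  constructor
  · rintro ⟨⟨B, r⟩, ⟨hB, hr⟩, hV⟩
    refine ⟨((r : 𝕜)⁻¹) • B,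
      Bornology.IsVonNBounded.image hB (((r : 𝕜)⁻¹) • ContinuousLinearMap.id 𝕜 X), ?_⟩
    rw [polar_smul_set _ hr]
    exact fun f hf => hV fun x hx => mem_closedBall_zero_iff.mpr (hf x hx)
  · rintro ⟨B, hB, hV⟩
    exact ⟨(B, 1), ⟨hB, one_pos⟩, fun f hf => hV fun x hx => mem_closedBall_zero_iff.mp (hf x hx)⟩

theorem isVonNBounded_iff (hτ : IsLCHTopology 𝕜 τ) {D : Set (BoundedlyContinuousDual 𝕜 τ τt)} :
    Bornology.IsVonNBounded 𝕜 D ↔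
      ∀ B ∈ boundedSets 𝕜 τ, Absorbs 𝕜 ((pairing 𝕜 τ τt).polar D) B := by
  have key : ∀ B, Absorbs 𝕜 ((pairing 𝕜 τ τt).flip.polar B) D ↔
      Absorbs 𝕜 ((pairing 𝕜 τ τt).polar D) B := fun B => by
    rw [absorbs_polar_iff, absorbs_polar_iff]
    exact exists_congr fun M => ⟨fun h u hu f hf => h f hf u hu, fun h f hf u hu => h u hu f hf⟩
  constructor
  · exact fun h B hB => (key B).mp (h ((mem_nhds_zero_iff hτ).mpr ⟨B, hB, subset_rfl⟩))
  · intro h V hV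
    obtain ⟨B, hB, hV⟩ := (mem_nhds_zero_iff hτ).mp hV
    exact ((key B).mpr (h B hB)).mono_left hV

section Evaluation

variable [LCHSpace 𝕜 (BoundedlyContinuousDual 𝕜 τ τt)]

theorem continuous_pairing_flip (hτ : IsLCHTopology 𝕜 τ) (f : X) :
    Continuous ((pairing 𝕜 τ τt).flip f) := by
  have hf : ∀ r : ℝ, 0 < r → {u | ‖(pairing 𝕜 τ τt).flip f u‖ ≤ r} ∈ 𝓝 0 := fun r hr => by
    let := τ
    have : LCHSpace 𝕜 X := hτ
    refine (mem_nhds_zero_iff hτ).mpr ⟨((r : 𝕜)⁻¹) • {f}, ?_, ?_⟩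
    · rw [Set.smul_set_singleton]
      exact Bornology.isVonNBounded_singleton _
    · rw [polar_smul_set _ hr]
      exact fun u hu => hu f rfl
  refine continuous_of_continuousAt_zero _ ?_
  rw [ContinuousAt, map_zero, Metric.nhds_basis_closedBall.tendsto_right_iff]
  exact fun r hr => by
    simpa only [mem_closedBall_zero_iff] using! hf r hr

/-- The evaluation `f ↦ (u ↦ u f)` of `X` in the dual of `X'_{𝓑,τt}`. -/
def eval (hτ : IsLCHTopology 𝕜 τ) :
    X →ₗ[𝕜] StrongDual 𝕜 (BoundedlyContinuousDual 𝕜 τ τt) where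
  toFun f := ⟨(pairing 𝕜 τ τt).flip f, continuous_pairing_flip hτ f⟩
  map_add' f g := by ext u; simp
  map_smul' c f := by ext u; simp

theorem eval_injective (hτ : IsLCHTopology 𝕜 τ) (hτt : IsLCHTopology 𝕜 τt) :
    Function.Injective (eval (τt := τt) hτ) := by
  let := τt
  have : LCHSpace 𝕜 X := hτt
  refine (injective_iff_map_eq_zero _).mpr fun f hf => ?_
  exact eq_zero_of_forall_strongDual_eq_zero fun g : StrongDual 𝕜 X =>
    DFunLike.congr_fun hf (ofContinuous g.toLinearMap g.continuous)

theorem eval_surjective (hτ : IsLCHTopology 𝕜 τ) (hBBC : SatisfiesBBC 𝕜 τ τt) :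
    Function.Surjective (eval (τt := τt) hτ) := by
  intro T
  have hT : {u | ‖T u‖ ≤ 1} ∈ 𝓝 0 := by
    have h : {u | ‖T u‖ < 1} ∈ 𝓝 0 :=
      (isOpen_lt T.continuous.norm continuous_const).mem_nhds (by simp)
    exact Filter.mem_of_superset h fun u (hu : ‖T u‖ < 1) => hu.le
  obtain ⟨B, hB, hBT⟩ := (mem_nhds_zero_iff hτ).mp hT
  -- Adding `0` guarantees that `K` is nonempty.
  have hB0 : insert 0 B ∈ boundedSets 𝕜 τ := by
    let := τ
    have : LCHSpace 𝕜 X := hτ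
    exact (Bornology.isVonNBounded_insert 0).mpr hB
  obtain ⟨K, hKb, hBK, hK, hKc⟩ := hBBC _ hB0
  let := τt
  obtain ⟨f, -, hf⟩ := exists_mem_forall_eq_of_isCompact (pairing 𝕜 τ τt) hK
    ⟨0, hBK (Set.mem_insert _ _)⟩ hKc (fun u => continuousOn_pairing u hKb) T.toLinearMap
    fun u hu => hBT fun f hf => hu f (hBK (Set.mem_insert_of_mem _ hf))
  exact ⟨f, ContinuousLinearMap.ext fun u => (hf u).symm⟩

/-- The polar of a bounded subset of the predual absorbs every `τ`-bounded set. -/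
theorem continuous_eval (hτ : IsLCHTopology 𝕜 τ) (hborn : IsBornologicalTopology 𝕜 τ) :
    @Continuous X _ τ _ (eval (τt := τt) hτ) := by
  let := τ
  have : LCHSpace 𝕜 X := hτ
  refine continuous_of_continuousAt_zero _ ?_
  rw [ContinuousAt, map_zero]
  intro V hV
  obtain ⟨D, hD, hDV⟩ := mem_nhds_zero_strongDual_iff.mp hV
  have h := hborn ((pairing 𝕜 τ τt).polar D) (absConvex_polar _ _) ((isVonNBounded_iff hτ).mp hD)
  exact Filter.mem_of_superset h fun f hf => hDV hf

theorem image_eval_mem_nhds (hτ : IsLCHTopology 𝕜 τ) (hτt : IsLCHTopology 𝕜 τt)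
    (hCNC : SatisfiesCNC 𝕜 τ τt) (hsurj : Function.Surjective (eval (τt := τt) hτ))
    {V : Set X} (hV : V ∈ @nhds X τ 0) : eval (τt := τt) hτ '' V ∈ 𝓝 0 := by
  obtain ⟨U, hU, hUV, habs, hcl⟩ := hCNC V hV
  have hD : Bornology.IsVonNBounded 𝕜 ((pairing 𝕜 τ τt).flip.polar U) := by
    refine (isVonNBounded_iff hτ).mpr fun B hB => ?_
    refine Absorbs.mono_left (s₁ := U) ?_ fun f hf u hu => hu f hf
    exact hB hU
  refine mem_nhds_zero_strongDual_iff.mpr ⟨_, hD, fun T hT => ?_⟩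
  obtain ⟨f, rfl⟩ := hsurj T
  refine ⟨f, hUV ?_, rfl⟩
  by_contra hf
  let := τt
  have : LCHSpace 𝕜 X := hτt
  have hne : U.Nonempty := ⟨0, @mem_of_mem_nhds X τ _ _ hU⟩
  -- Since `U` is `τt`-closed, the separating functional is `τt`-continuous and so lies in the
  -- predual.
  obtain ⟨g, hg, hgf⟩ := exists_strongDual_lt_norm habs hne hcl hf
  exact absurd (hT (ofContinuous g.toLinearMap g.continuous) hg) (not_le.mpr hgf)

/-- The evaluation is a topological isomorphism of `(X, τ)` onto the strong dual of
`X'_{𝓑,τt}`. -/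
noncomputable def evalIso (hτ : IsLCHTopology 𝕜 τ) (hborn : IsBornologicalTopology 𝕜 τ)
    (hτt : IsLCHTopology 𝕜 τt) (hBBC : SatisfiesBBC 𝕜 τ τt) (hCNC : SatisfiesCNC 𝕜 τ τt) :
    PredualIso 𝕜 τ (BoundedlyContinuousDual 𝕜 τ τt) :=
  letI := τ
  { LinearEquiv.ofBijective (eval (τt := τt) hτ)
      ⟨eval_injective hτ hτt, eval_surjective hτ hBBC⟩ with
    continuous_toFun := continuous_eval hτ hborn
    continuous_invFun := by
      have : LCHSpace 𝕜 X := hτ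
      let e := LinearEquiv.ofBijective (eval (τt := τt) hτ)
        ⟨eval_injective hτ hτt, eval_surjective hτ hBBC⟩
      change Continuous e.symm
      refine continuous_of_continuousAt_zero _ ?_
      rw [ContinuousAt, map_zero]
      intro V hV
      rw [Filter.mem_map]
      refine Filter.mem_of_superset
        (image_eval_mem_nhds hτ hτt hCNC (eval_surjective hτ hBBC) hV) ?_
      rintro _ ⟨f, hf, rfl⟩
      change e.symm (e f) ∈ V
      rwa [e.symm_apply_apply] }

end Evaluation

end BoundedlyContinuousDual

end BoundedlyContinuousDual

/-! ### Comparing a complete barrelled predual with the canonical one -/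

section Representation

variable {𝕜 : Type v} {X : Type u} [RCLike 𝕜] [AddCommGroup X] [Module 𝕜 X]
  {τ τt : TopologicalSpace X}
  {Z : Type*} [AddCommGroup Z] [Module 𝕜 Z] [TopologicalSpace Z]

open BoundedlyContinuousDual

/-- A topological isomorphism onto a strong dual as a bilinear form. -/
def PredualIso.form (ψ : PredualIso 𝕜 τ Z) : X →ₗ[𝕜] Z →ₗ[𝕜] 𝕜 where
  toFun f := (ψ f).toLinearMap
  map_add' f g := by
    let := τ
    ext z
    exact DFunLike.congr_fun (ψ.toLinearEquiv.map_add f g) z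
  map_smul' c f := by
    let := τ
    ext z
    exact DFunLike.congr_fun (ψ.toLinearEquiv.map_smul c f) z

theorem PredualIso.isVonNBounded_image (ψ : PredualIso 𝕜 τ Z) {B : Set X}
    (hB : B ∈ boundedSets 𝕜 τ) : Bornology.IsVonNBounded 𝕜 (ψ '' B) := by
  let := τ
  exact Bornology.IsVonNBounded.image hB (ψ : X →L[𝕜] StrongDual 𝕜 Z)

theorem PredualIso.preimage_mem_boundedSets (ψ : PredualIso 𝕜 τ Z) {D : Set (StrongDual 𝕜 Z)}
    (hD : Bornology.IsVonNBounded 𝕜 D) : ψ ⁻¹' D ∈ boundedSets 𝕜 τ := by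
  let := τ
  have h := Bornology.IsVonNBounded.image hD (ψ.symm : StrongDual 𝕜 Z →L[𝕜] X)
  refine Bornology.IsVonNBounded.subset ?_ h
  exact fun f hf => ⟨ψ f, hf, ψ.symm_apply_apply f⟩

variable [LCHSpace 𝕜 Z]

theorem PredualIso.polar_mem_nhds [BarrelledSpace 𝕜 Z] (ψ : PredualIso 𝕜 τ Z) {B : Set X}
    (hB : B ∈ boundedSets 𝕜 τ) : ψ.form.polar B ∈ 𝓝 (0 : Z) := by
  refine Filter.mem_of_superset
    (polar_mem_nhds_zero_of_isVonNBounded (ψ.isVonNBounded_image hB)) ?_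
  exact fun z hz f hf => hz (ψ f) ⟨f, hf, rfl⟩

/-- Bipolar theorem: with `polar_mem_nhds`, polars of `τ`-bounded sets form a basis at `0` in `Z`.
-/
theorem PredualIso.exists_polar_subset (ψ : PredualIso 𝕜 τ Z) {V : Set Z} (hV : V ∈ 𝓝 (0 : Z)) :
    ∃ B ∈ boundedSets 𝕜 τ, ψ.form.polar B ⊆ V := by
  obtain ⟨U, ⟨hU, hcl, habs⟩, hUV⟩ := (nhds_hasBasis_absConvex_closed 𝕜 Z).mem_iff.mp hV
  refine ⟨_, ψ.preimage_mem_boundedSets (isVonNBounded_strongDual_polar hU), fun z hz => hUV ?_⟩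
  by_contra hzU
  obtain ⟨g, hg, hgz⟩ := exists_strongDual_lt_norm habs ⟨0, mem_of_mem_nhds hU⟩ hcl hzU
  let := τ
  have hψ : ψ (ψ.symm g) = g := ψ.apply_symm_apply g
  have h1 : ‖ψ (ψ.symm g) z‖ ≤ 1 := hz (ψ.symm g) (by
    change ψ (ψ.symm g) ∈ (topDualPairing 𝕜 Z).flip.polar U
    rw [hψ]
    exact hg)
  rw [hψ] at h1
  exact absurd h1 (not_le.mpr hgz)

/-- If a dense set of elements of `Z` acts `τt`-continuously on `X`, all elements of `Z` act
`τt`-continuously on `τ`-bounded sets. -/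
theorem PredualIso.form_flip_mem [BarrelledSpace 𝕜 Z] (ψ : PredualIso 𝕜 τ Z)
    (hd : ∀ z : Z, z ∈ closure {y : Z | @Continuous X 𝕜 τt _ (ψ.form.flip y)}) (z : Z) :
    ψ.form.flip z ∈ boundedlyContinuousDual 𝕜 τ τt := by
  intro B hB
  let := τt
  refine continuousOn_of_uniform_approx_of_continuousOn fun u hu => ?_
  obtain ⟨ε, hε, hεu⟩ := Metric.mem_uniformity_dist.mp hu
  obtain ⟨c, hc0, hc⟩ := NormedField.exists_norm_lt 𝕜 hε
  have hc0' : c ≠ 0 := norm_pos_iff.mp hc0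
  -- For such `y`, the functionals of `y` and `z` differ by at most `‖c‖ < ε` on `B`.
  have hN : {y : Z | c⁻¹ • (z - y) ∈ ψ.form.polar B} ∈ 𝓝 z := by
    have hcont : Continuous fun y : Z => c⁻¹ • (z - y) := by fun_prop
    exact hcont.continuousAt.preimage_mem_nhds (by simpa using ψ.polar_mem_nhds hB)
  obtain ⟨y, hyN, hy⟩ := mem_closure_iff_nhds.mp (hd z) _ hN
  refine ⟨ψ.form.flip y, Continuous.continuousOn hy, fun f hf => hεu ?_⟩
  have h := hyN f hf
  rw [map_smul, smul_eq_mul, norm_mul, norm_inv, inv_mul_le_iff₀ hc0, mul_one, map_sub] at h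
  rw [dist_eq_norm]
  exact h.trans_lt hc

variable [LCHSpace 𝕜 (BoundedlyContinuousDual 𝕜 τ τt)]

theorem PredualIso.nonempty_equiv_of_form_flip_mem [BarrelledSpace 𝕜 Z] (hZ : IsCompleteTVS Z)
    (hτ : IsLCHTopology 𝕜 τ) (hBBC : SatisfiesBBC 𝕜 τ τt) (ψ : PredualIso 𝕜 τ Z)
    (hψ : ∀ z, ψ.form.flip z ∈ boundedlyContinuousDual 𝕜 τ τt) :
    Nonempty (Z ≃L[𝕜] BoundedlyContinuousDual 𝕜 τ τt) := by
  let j : Z →ₗ[𝕜] BoundedlyContinuousDual 𝕜 τ τt :=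
    { toFun := fun z => ⟨ψ.form.flip z, hψ z⟩
      map_add' := fun y z => Subtype.ext (map_add ψ.form.flip y z)
      map_smul' := fun c z => Subtype.ext (map_smul ψ.form.flip c z) }
  have hjp : ∀ B : Set X, j ⁻¹' ((pairing 𝕜 τ τt).flip.polar B) = ψ.form.polar B := fun _ => rfl
  have hnhds : 𝓝 (0 : Z) = Filter.comap j (𝓝 0) := by
    ext V
    rw [Filter.mem_comap]
    constructor
    · intro hV
      obtain ⟨B, hB, hBV⟩ := ψ.exists_polar_subset hV
      exact ⟨_, (mem_nhds_zero_iff hτ).mpr ⟨B, hB, subset_rfl⟩, (hjp B).trans_subset hBV⟩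
    · rintro ⟨V', hV', hV⟩
      obtain ⟨B, hB, hBV⟩ := (mem_nhds_zero_iff hτ).mp hV'
      refine Filter.mem_of_superset (ψ.polar_mem_nhds hB) ?_
      rw [← hjp]
      exact (Set.preimage_mono hBV).trans hV
  -- The comparison of neighbourhoods at `0` is carried to `z` by translation.
  have hind : IsInducing j := by
    refine isInducing_iff_nhds.mpr fun z => ?_
    rw [← map_add_left_nhds_zero z, ← map_add_left_nhds_zero (j z), hnhds]
    ext V
    simp only [Filter.mem_map, Filter.mem_comap]
    constructor
    · rintro ⟨U, hU, hUV⟩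
      have hU' : (fun w => j z + w) ⁻¹' ((fun w => -j z + w) ⁻¹' U) = U := by
        ext w
        simp
      refine ⟨(fun w => -j z + w) ⁻¹' U, by rwa [hU'], fun y hy => ?_⟩
      have := @hUV (-z + y) (by simpa using! hy)
      simpa using! this
    · rintro ⟨U, hU, hUV⟩
      exact ⟨_, hU, fun y hy => hUV (by simpa using! hy)⟩
  have hinj : Function.Injective j := hind.injective
  have hclosed : IsClosed (Set.range j) := by
    let := IsTopologicalAddGroup.rightUniformSpace Z
    let := IsTopologicalAddGroup.rightUniformSpace (BoundedlyContinuousDual 𝕜 τ τt)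
    have : IsUniformAddGroup Z := isUniformAddGroup_of_addCommGroup
    have : IsUniformAddGroup (BoundedlyContinuousDual 𝕜 τ τt) := isUniformAddGroup_of_addCommGroup
    have : CompleteSpace Z := hZ
    exact (AddMonoidHom.isUniformInducing_of_isInducing hind).isComplete_range.isClosed
  have hsurj : Function.Surjective j := by
    intro u
    have h := mem_closure_submodule_of_forall_strongDual (LinearMap.range j) (fun T hT => ?_) u
    · rwa [LinearMap.coe_range, hclosed.closure_eq] at h
    -- A functional vanishing on the range is evaluation at some `f` with `ψ f = 0`, hence zero.
    · obtain ⟨f, rfl⟩ := eval_surjective hτ hBBC T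
      have hf : ψ f = 0 := ContinuousLinearMap.ext fun z => hT (j z) ⟨z, rfl⟩
      let := τ
      have hf0 : f = 0 := ψ.toLinearEquiv.map_eq_zero_iff.mp hf
      rw [hf0, map_zero]
  let e := LinearEquiv.ofBijective j ⟨hinj, hsurj⟩
  exact ⟨{ e with
    continuous_toFun := hind.continuous
    continuous_invFun := by
      rw [hind.continuous_iff]
      exact continuous_id.congr fun u => (e.apply_symm_apply u).symm }⟩

/-- A complete barrelled predual containing a separating family of `τt`-continuous functionals is
isomorphic to `X'_{𝓑,τt}`. -/
theorem PredualIso.nonempty_equiv_of_points [BarrelledSpace 𝕜 Z] (hZ : IsCompleteTVS Z)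
    (hτ : IsLCHTopology 𝕜 τ) (hBBC : SatisfiesBBC 𝕜 τ τt) {Ω : Type*} (ev : Ω → X →ₗ[𝕜] 𝕜)
    (hev : ∀ x, @Continuous X 𝕜 τt _ (ev x)) (hsep : ∀ f, (∀ x, ev x f = 0) → f = 0)
    (ψ : PredualIso 𝕜 τ Z) (hψ : ∀ x, ∃ z, ∀ f, ev x f = ψ f z) :
    Nonempty (Z ≃L[𝕜] BoundedlyContinuousDual 𝕜 τ τt) := by
  refine ψ.nonempty_equiv_of_form_flip_mem hZ hτ hBBC (ψ.form_flip_mem ?_)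
  let S : Submodule 𝕜 Z :=
    { carrier := {y : Z | @Continuous X 𝕜 τt _ (ψ.form.flip y)}
      add_mem' := fun {y z} hy hz => by
        change @Continuous X 𝕜 τt _ (ψ.form.flip (y + z))
        rw [map_add]
        exact @Continuous.add _ _ _ _ _ τt _ _ hy hz
      zero_mem' := by
        change @Continuous X 𝕜 τt _ (ψ.form.flip 0)
        rw [map_zero]
        exact @continuous_const _ _ τt _ _
      smul_mem' := fun c y hy => by
        change @Continuous X 𝕜 τt _ (ψ.form.flip (c • y))
        rw [map_smul]
        exact @Continuous.const_smul _ _ _ _ _ _ τt _ hy c }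
  refine mem_closure_submodule_of_forall_strongDual S fun T hT => ?_
  let := τ
  obtain ⟨f, rfl⟩ := ψ.toLinearEquiv.surjective T
  have hf : f = 0 := hsep f fun x => by
    obtain ⟨z, hz⟩ := hψ x
    rw [hz f]
    refine hT z ?_
    have : ψ.form.flip z = ev x := LinearMap.ext fun g => (hz g).symm
    change @Continuous X 𝕜 τt _ (ψ.form.flip z)
    rw [this]
    exact hev x
  rw [hf, map_zero]

end Representation

/-! ### Transport of preduals -/

section Transport

variable {𝕜 : Type v} {X : Type u} [RCLike 𝕜] [AddCommGroup X] [Module 𝕜 X]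
  {τ : TopologicalSpace X}
  {W Z : Type*} [AddCommGroup W] [Module 𝕜 W] [TopologicalSpace W]
  [AddCommGroup Z] [Module 𝕜 Z] [TopologicalSpace Z]

/-- Transport of a predual along an isomorphism. -/
theorem PredualIso.exists_transport (φ : PredualIso 𝕜 τ W) (e : Z ≃L[𝕜] W) :
    ∃ ψ : PredualIso 𝕜 τ Z, ∀ f z, ψ f z = φ f (e z) := by
  let := τ
  exact ⟨ContinuousLinearEquiv.trans φ (e.symm.arrowCongr (ContinuousLinearEquiv.refl 𝕜 𝕜)),
    fun f z => rfl⟩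

theorem PredualIso.eq_of_forall_apply_eq [LCHSpace 𝕜 Z] (ψ : PredualIso 𝕜 τ Z) {y z : Z}
    (h : ∀ f, ψ f y = ψ f z) : y = z := by
  rw [← sub_eq_zero]
  refine eq_zero_of_forall_strongDual_eq_zero fun T : StrongDual 𝕜 Z => ?_
  obtain ⟨f, rfl⟩ := ψ.toLinearEquiv.surjective T
  rw [map_sub, sub_eq_zero]
  exact h f

end Transport

end Predual

/-! ### The equivalence -/

theorem mainTheorem11 {𝕜 : Type} [RCLike 𝕜] {Ω : Type u} [Nonempty Ω]
    (F : Submodule 𝕜 (Ω → 𝕜)) (τ τt : TopologicalSpace F)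
    (hτ : Predual.IsLCHTopology 𝕜 τ)
    (hborn : Predual.IsBornologicalTopology 𝕜 τ)
    (hBC : Predual.IsBCTopology 𝕜 τ)
    (hτt : Predual.IsLCHTopology 𝕜 τt)
    -- `τt` is finer than the topology of pointwise convergence
    (hp : τt ≤ Predual.pointwiseTopology F)
    (hBBC : Predual.SatisfiesBBC 𝕜 τ τt)
    (hCNC : Predual.SatisfiesCNC 𝕜 τ τt)
    (C : Predual.SpaceClass.{u} 𝕜)
    (hC : C.SubCompleteBarrelled)
    (hCiso : C.ClosedUnderIso)
    (hCF : C (Predual.BoundedlyContinuousDual 𝕜 τ τt)) :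
    Predual.HasUniquePredual τ C ↔
      ∀ (Z : Type u) [AddCommGroup Z] [Module 𝕜 Z] [TopologicalSpace Z] [Predual.LCHSpace 𝕜 Z]
        (_φ : Predual.PredualIso 𝕜 τ Z), C Z →
        ∃ ψ : Predual.PredualIso 𝕜 τ Z, ∀ x : Ω, ∃! z : Z, ∀ f : F, (f : Ω → 𝕜) x = ψ f z := by
  obtain ⟨hW, -, -⟩ := hC _ hCF
  let ev : Ω → F →ₗ[𝕜] 𝕜 := fun x => LinearMap.proj x ∘ₗ F.subtype
  have hev : ∀ x, @Continuous F 𝕜 τt _ (ev x) := fun x => by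
    have h : @Continuous F 𝕜 (Predual.pointwiseTopology F) _ (ev x) := by
      let := Predual.pointwiseTopology F
      exact (continuous_apply (A := fun _ : Ω => 𝕜) x).comp continuous_induced_dom
    exact continuous_le_dom hp h
  constructor
  · intro hu Z _ _ _ _ φ hZ
    let I := Predual.BoundedlyContinuousDual.evalIso hτ hborn hτt hBBC hCNC
    obtain ⟨e⟩ := hu Z _ φ I hZ hCF
    obtain ⟨ψ, hψ⟩ := I.exists_transport e
    refine ⟨ψ, fun x => ?_⟩
    have hz : ∀ f : F, (f : Ω → 𝕜) x =
        ψ f (e.symm (Predual.BoundedlyContinuousDual.ofContinuous (ev x) (hev x))) := fun f => by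
      rw [hψ, e.apply_symm_apply]
      rfl
    exact ⟨_, hz, fun y hy => ψ.eq_of_forall_apply_eq fun f => (hy f).symm.trans (hz f)⟩
  · intro hb
    have key : ∀ (Z : Type u) [AddCommGroup Z] [Module 𝕜 Z] [TopologicalSpace Z]
        [Predual.LCHSpace 𝕜 Z] (_ : Predual.PredualIso 𝕜 τ Z), C Z →
        Nonempty (Z ≃L[𝕜] Predual.BoundedlyContinuousDual 𝕜 τ τt) := by
      intro Z _ _ _ _ φ hZ
      obtain ⟨_, hZc, hZb⟩ := hC Z hZ
      obtain ⟨ψ, hψ⟩ := hb Z φ hZ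
      exact Predual.PredualIso.nonempty_equiv_of_points hZc hτ hBBC ev hev
        (fun f hf => Subtype.ext (funext hf)) ψ fun x => (hψ x).exists
    intro Y Z _ _ _ _ _ _ _ _ φ ψ hY hZ
    obtain ⟨e⟩ := key Y φ hY
    obtain ⟨e'⟩ := key Z ψ hZ
    exact ⟨e.trans e'.symm⟩
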